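/- All normed spaces are real. For subsets $K,B$ of a normed space $X$, with $B$ convex, symmetric about the origin and with non-empty interior, let $M(K,B)\in\mathbb N\cup\{\infty\}$ be the packing number, that is, the supremum of the cardinalities of sets $S\subseteq K$ such that the translates $x+\operatorname{int}B$, $x\in S$, are pairwise disjoint, and let $$\hat M(K,B)=\sup\bigl\{N:\ \exists\,x_1,\dots,x_N\in K\ \text{ with }\ (x_j+\operatorname{int}B)\cap\operatorname{conv}\{x_i:i<j\}=\emptyset\ \text{ for all } j\bigr\}.$$ Logarithms are to the base $2$, with $\log 0=-\infty$ and $\log\infty=\infty$. Let $K(X)\in[0,\infty]$ be the $K$-convexity constant of $X$, that is, the supremum over $n$ of the norms of the Rademacher projections $f\mapsto\sum_{i=1}^n\varepsilon_i\,\mathbb E_\delta[\delta_i f(\delta)]$ on $L_2(\{-1,1\}^n;X)$, where $\{-1,1\}^n$ carries the uniform probability measure; $X$ is $K$-convex if $K(X)<\infty$. **Theorem.** Let $X$ be a $K$-convex normed space with $K(X)\le\kappa<\infty$ and closed unit ball $B$. Then for every bounded set $T\subset X$, $$\log M(T,B)\le\beta\,\log\hat M(T,B/2),$$ where $\beta\in(0,\infty)$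 depends only on $\kappa$ and on the diameter of $T$. Likewise, if $r>0$ and $U\subset X$ is a convex set, symmetric about the origin, with $U\supseteq rB$, then $$\log M(B,U)\le\beta'\,\log\hat M(B,U/2),$$ where $\beta'\in(0,\infty)$ depends only on $\kappa$ and $r$. -/

import Mathlib

open scoped NNReal ENNReal Pointwise

universe u

noncomputable section

/-- The packing number `M(K, B)` in `ℕ∞`: the supremum of the cardinalities of the sets `S ⊆ K`
such that the translates `x + int B`, `x ∈ S`, are pairwise disjoint. -/
def packNum {X : Type*} [NormedAddCommGroup X] (K B : Set X) : ℕ∞ :=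
  ⨆ (S : Set X) (_ : S ⊆ K) (_ : S.PairwiseDisjoint fun x => x +ᵥ interior B), S.encard

/-- A finite sequence `x₁, …, x_N` is `B`-convexly separated if `x_j + int B` does not meet the
convex hull of the earlier points `x_i`, `i < j`, for every `j`. -/
def IsConvexlySeparated {X : Type*} [NormedAddCommGroup X] [NormedSpace ℝ X] (B : Set X)
    {N : ℕ} (x : Fin N → X) : Prop :=
  ∀ j, (x j +ᵥ interior B) ∩ convexHull ℝ {y | ∃ i < j, y = x i} = ∅

/-- The convexified packing number `M̂(K, B)` in `ℕ∞`: the supremum of the lengths of the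
`B`-convexly separated sequences in `K`. -/
def convPackNum {X : Type*} [NormedAddCommGroup X] [NormedSpace ℝ X] (K B : Set X) : ℕ∞ :=
  ⨆ (N : ℕ) (_ : ∃ x : Fin N → X, (∀ j, x j ∈ K) ∧ IsConvexlySeparated B x), (N : ℕ∞)

/-- The logarithm to the base 2 on `ℕ∞`, with values in `[-∞, ∞]`: `log 0 = -∞`, `log ∞ = ∞`. -/
def log₂ (n : ℕ∞) : EReal :=
  ENNReal.log (n : ℝ≥0∞) / ((Real.log 2 : ℝ) : EReal)

/-- The norm of `L₂({-1,1}ⁿ; X)`, for the uniform probability measure on `{-1,1}ⁿ`. -/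
def cubeL2Norm {X : Type*} [NormedAddCommGroup X] {n : ℕ} (f : (Fin n → ℤˣ) → X) : ℝ :=
  √((2 ^ n : ℝ)⁻¹ * ∑ ε, ‖f ε‖ ^ 2)

/-- The Rademacher projection on `L₂({-1,1}ⁿ; X)`: `(R f)(ε) = ∑ᵢ εᵢ 𝔼_δ[δᵢ f(δ)]`. -/
def rademacherProj {X : Type*} [NormedAddCommGroup X] [NormedSpace ℝ X] {n : ℕ}
    (f : (Fin n → ℤˣ) → X) (ε : Fin n → ℤˣ) : X :=
  ∑ i, ((ε i : ℤ) : ℝ) • ((2 ^ n : ℝ)⁻¹ • ∑ δ : Fin n → ℤˣ, ((δ i : ℤ) : ℝ) • f δ)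

/-- The `K`-convexity constant `K(X)` in `[0, ∞]`: the supremum over `n` of the operator norms of
the Rademacher projections on `L₂({-1,1}ⁿ; X)`, written as the least common bound
(`∞` if there is none). `X` is `K`-convex when it is finite. -/
def kConvexityConst (X : Type*) [NormedAddCommGroup X] [NormedSpace ℝ X] : ℝ≥0∞ :=
  ⨅ (C : ℝ≥0) (_ : ∀ (n : ℕ) (f : (Fin n → ℤˣ) → X),
    cubeL2Norm (rademacherProj f) ≤ C * cubeL2Norm f), (C : ℝ≥0∞)

end

/-!
If all signed sums of the `2ⁿ` vectors `x ω`, `ω ∈ {-1,1}ⁿ`, had nearly the largest possible norm,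
these vectors would span a copy of `ℓ₁`, and the Rademacher projection of `x` at `ε`, whose
coefficients are `∑ i, εᵢ ωᵢ`, would have norm about `√(n/3)` by Khintchine's inequality. So for
`n > 3 (κ + 1)²` any `2ⁿ` vectors of the unit ball have a signed sum of norm at most
`(1 - 1/n) 2ⁿ`. Such bounds are submultiplicative in the number of vectors, whence a summable bound
for the least signed sums of `2ᵗ` vectors, divided by `2ᵗ`.

Choosing one point from each of `2ᵗ` pairs turns an average of `2ᵗ⁺¹` points of `A` into an average
of `2ᵗ` of them. The error is half a signed average of the differences of the pairs, so it can be
made small. Summing these errors, every point of `conv A` lies close to an average of `2ˢ` points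
of `A`, with `s` depending only on `κ`, the diameter and the distance allowed.

Finally let `x₁, …, x_N` be a longest `U/2`-convexly separated sequence in `T`. For every `a ∈ T`
the translate `a + int (U/2)` meets `conv {x₁, …, x_N}`, so `a + int U` contains one of the `N^(2ˢ)`
averages of `2ˢ` of the `xᵢ`, and disjoint translates contain different ones.
-/

section Khintchine

lemma sum_cube_succ {n : ℕ} (F : ℝ → ℝ) (a : Fin (n + 1) → ℝ) :
    ∑ ω : Fin (n + 1) → ℤˣ, F (∑ i, ω i • a i) =
      ∑ ω : Fin n → ℤˣ, (F (a 0 + ∑ i, ω i • a i.succ) + F (-a 0 + ∑ i, ω i • a i.succ)) := by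
  have univ_units : (Finset.univ : Finset ℤˣ) = {1, -1} := rfl
  rw [← (Fin.consEquiv fun _ : Fin (n + 1) => ℤˣ).sum_comp, Fintype.sum_prod_type,
    Finset.sum_add_distrib, univ_units, Finset.sum_pair (by decide)]
  simp [Fin.consEquiv, Fin.sum_univ_succ]

lemma sum_cube_sq {n : ℕ} (a : Fin n → ℝ) :
    ∑ ω : Fin n → ℤˣ, (∑ i, ω i • a i) ^ 2 = 2 ^ n * ∑ i, a i ^ 2 := by
  induction n with
  | zero => simp
  | succ n ih =>
    have parallelogram (s : ℝ) : (a 0 + s) ^ 2 + (-a 0 + s) ^ 2 = 2 * s ^ 2 + 2 * a 0 ^ 2 := by ring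
    rw [sum_cube_succ (· ^ 2), Fin.sum_univ_succ]
    simp only [parallelogram, Finset.sum_add_distrib, ← Finset.mul_sum, ih, Finset.sum_const,
      Finset.card_univ, Fintype.card_pi_const, Fintype.card_units_int, nsmul_eq_mul]
    push_cast
    ring

lemma sum_cube_pow_four_le {n : ℕ} (a : Fin n → ℝ) :
    ∑ ω : Fin n → ℤˣ, (∑ i, ω i • a i) ^ 4 ≤ 2 ^ n * (3 * (∑ i, a i ^ 2) ^ 2) := by
  induction n with
  | zero => simp
  | succ n ih =>
    have expand (s : ℝ) : (a 0 + s) ^ 4 + (-a 0 + s) ^ 4 =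
        2 * s ^ 4 + 12 * a 0 ^ 2 * s ^ 2 + 2 * a 0 ^ 4 := by ring
    rw [sum_cube_succ (· ^ 4), Fin.sum_univ_succ]
    simp only [expand, Finset.sum_add_distrib, ← Finset.mul_sum, sum_cube_sq, Finset.sum_const,
      Finset.card_univ, Fintype.card_pi_const, Fintype.card_units_int, nsmul_eq_mul]
    push_cast
    have : 0 ≤ (2 : ℝ) ^ n * a 0 ^ 4 := by positivity
    linear_combination 2 * ih (fun i => a i.succ) + 4 * this

lemma three_mul_sq_mul_sq_sub_pow_four_le {t : ℝ} (ht : 0 ≤ t) (s : ℝ) :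
    3 * t ^ 2 * s ^ 2 - s ^ 4 ≤ 2 * t ^ 3 * |s| := by
  have nonneg : 0 ≤ |s| * (|s| - t) ^ 2 * (|s| + 2 * t) := by positivity
  rw [show s ^ 4 = (s ^ 2) ^ 2 by ring, ← sq_abs s]
  linear_combination nonneg

/-- Khintchine's inequality between the `L₁` and `L₂` norms: integrate the quartic minorant of `|s|`
above, which touches `|s|` at `|s| = t`, for `t = √3 σ`. -/
lemma two_pow_mul_sqrt_le_sum_cube_abs {n : ℕ} (a : Fin n → ℝ) :
    2 ^ n * √(∑ i, a i ^ 2) ≤ √3 * ∑ ω : Fin n → ℤˣ, |∑ i, ω i • a i| := by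
  set σ := √(∑ i, a i ^ 2)
  have hσ : σ ^ 2 = ∑ i, a i ^ 2 := Real.sq_sqrt (by positivity)
  have h3 : √3 ^ 2 = 3 := Real.sq_sqrt (by norm_num)
  have hσ0 : 0 ≤ σ := Real.sqrt_nonneg _
  obtain hσ_zero | hσ_pos := hσ0.eq_or_lt
  · rw [← hσ_zero, mul_zero]
    positivity
  have minorant := Finset.sum_le_sum fun (ω : Fin n → ℤˣ) (_ : ω ∈ Finset.univ) =>
    three_mul_sq_mul_sq_sub_pow_four_le (t := √3 * σ) (by positivity) (∑ i, ω i • a i)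
  rw [Finset.sum_sub_distrib, ← Finset.mul_sum, ← Finset.mul_sum, sum_cube_sq, ← hσ] at minorant
  have fourth := sum_cube_pow_four_le a
  rw [← hσ] at fourth
  refine le_of_mul_le_mul_left ?_ (show 0 < 6 * σ ^ 3 by positivity)
  linear_combination minorant + fourth +
    (2 * σ ^ 3 * √3 * ∑ ω : Fin n → ℤˣ, |∑ i, ω i • a i| - 3 * 2 ^ n * σ ^ 4) * h3

end Khintchine

section KConvexity

variable {X : Type*} [NormedAddCommGroup X] {n : ℕ}

lemma cubeL2Norm_le {f : (Fin n → ℤˣ) → X} {L : ℝ} (hL : 0 ≤ L) (h : ∀ ε, ‖f ε‖ ≤ L) :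
    cubeL2Norm f ≤ L := by
  refine Real.sqrt_le_iff.2 ⟨hL, ?_⟩
  calc (2 ^ n : ℝ)⁻¹ * ∑ ε, ‖f ε‖ ^ 2 ≤ (2 ^ n : ℝ)⁻¹ * ∑ _ε : Fin n → ℤˣ, L ^ 2 := by
        gcongr with ε; exact h ε
    _ = L ^ 2 := by simp

lemma le_cubeL2Norm {f : (Fin n → ℤˣ) → X} {L : ℝ} (hL : 0 ≤ L) (h : ∀ ε, L ≤ ‖f ε‖) :
    L ≤ cubeL2Norm f := by
  refine Real.le_sqrt_of_sq_le ?_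
  calc L ^ 2 = (2 ^ n : ℝ)⁻¹ * ∑ _ε : Fin n → ℤˣ, L ^ 2 := by simp
    _ ≤ (2 ^ n : ℝ)⁻¹ * ∑ ε, ‖f ε‖ ^ 2 := by gcongr with ε; exact h ε

variable [NormedSpace ℝ X]

lemma rademacherProj_eq_sum_smul (f : (Fin n → ℤˣ) → X) (ε : Fin n → ℤˣ) :
    rademacherProj f ε = (2 ^ n : ℝ)⁻¹ • ∑ δ, (∑ i, δ i • ((ε i : ℤ) : ℝ)) • f δ := by
  simp only [rademacherProj, Units.smul_def, zsmul_eq_mul, Finset.sum_smul, Finset.smul_sum,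
    smul_smul]
  rw [Finset.sum_comm]
  refine Finset.sum_congr rfl fun δ _ => Finset.sum_congr rfl fun i _ => ?_
  congr 1
  ring

lemma cubeL2Norm_rademacherProj_le {κ : ℝ≥0} (hκ : kConvexityConst X ≤ κ)
    (f : (Fin n → ℤˣ) → X) : cubeL2Norm (rademacherProj f) ≤ κ * cubeL2Norm f := by
  have bound_of_gt (c : ℝ) (hc : c ∈ Set.Ioi (κ : ℝ)) :
      cubeL2Norm (rademacherProj f) ≤ c * cubeL2Norm f := by
    lift c to ℝ≥0 using κ.2.trans (le_of_lt hc)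
    have hlt : kConvexityConst X < c := hκ.trans_lt (by exact_mod_cast hc)
    simp only [kConvexityConst, iInf_lt_iff] at hlt
    obtain ⟨C, hC, hCc⟩ := hlt
    refine (hC n f).trans (mul_le_mul_of_nonneg_right ?_ (Real.sqrt_nonneg _))
    exact_mod_cast hCc.le
  have tendsto_bound : Filter.Tendsto (fun c => c * cubeL2Norm f) (nhdsWithin (κ : ℝ) (Set.Ioi κ))
      (nhds (κ * cubeL2Norm f)) := (Filter.tendsto_id.mul_const _).mono_left nhdsWithin_le_nhds
  exact ge_of_tendsto tendsto_bound (Filter.eventually_of_mem self_mem_nhdsWithin bound_of_gt)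

end KConvexity

section SignedSums

/-- A quantitative form of B-convexity: any `q` vectors of norm at most `D` have a signed sum of
norm at most `b * q * D`. Only `b < 1` carries information; it rules out almost isometric copies of
`ℓ₁^q` in `X`. -/
def SignedSumBound (X : Type*) [SeminormedAddCommGroup X] (q : ℕ) (b : ℝ) : Prop :=
  ∀ (D : ℝ) (x : Fin q → X), (∀ i, ‖x i‖ ≤ D) → ∃ s : Fin q → ℤˣ, ‖∑ i, s i • x i‖ ≤ b * q * D

section Group

variable {X : Type*} [SeminormedAddCommGroup X] {q q' : ℕ} {b b' : ℝ}

lemma norm_sum_units_smul_le {ι : Type*} [Fintype ι] {x : ι → X} {D : ℝ} (hx : ∀ i, ‖x i‖ ≤ D)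
    (s : ι → ℤˣ) : ‖∑ i, s i • x i‖ ≤ Fintype.card ι * D := by
  refine (norm_sum_le_of_le _ fun i _ => (norm_units_zsmul (s i) (x i)).trans_le (hx i)).trans_eq ?_
  simp

lemma signedSumBound_one (X : Type*) [SeminormedAddCommGroup X] (q : ℕ) :
    SignedSumBound X q 1 := fun D x hx =>
  ⟨1, by simpa using norm_sum_units_smul_le hx 1⟩

lemma signedSumBound_iff_of_card {ι : Type*} [Fintype ι] (hι : Fintype.card ι = q) :
    SignedSumBound X q b ↔ ∀ (D : ℝ) (x : ι → X), (∀ i, ‖x i‖ ≤ D) →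
      ∃ s : ι → ℤˣ, ‖∑ i, s i • x i‖ ≤ b * q * D := by
  have e : ι ≃ Fin q := Fintype.equivFinOfCardEq hι
  refine ⟨fun h D x hx => ?_, fun h D x hx => ?_⟩
  · obtain ⟨s, hs⟩ := h D (x ∘ e.symm) fun i => hx _
    exact ⟨s ∘ e, by simpa [← e.symm.sum_comp] using hs⟩
  · obtain ⟨s, hs⟩ := h D (x ∘ e) fun i => hx _
    exact ⟨s ∘ e.symm, by simpa [← e.sum_comp] using hs⟩

lemma SignedSumBound.mul (h : SignedSumBound X q b) (h' : SignedSumBound X q' b') :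
    SignedSumBound X (q * q') (b * b') := by
  intro D x hx
  choose s hs using fun i : Fin q => h' D (fun j => x (finProdFinEquiv (i, j))) fun j => hx _
  obtain ⟨t, ht⟩ := h _ _ hs
  refine ⟨fun k => t (finProdFinEquiv.symm k).1 *
    s (finProdFinEquiv.symm k).1 (finProdFinEquiv.symm k).2, ?_⟩
  rw [← finProdFinEquiv.sum_comp, Fintype.sum_prod_type]
  simp only [Equiv.symm_apply_apply, mul_smul, ← Finset.smul_sum]
  refine ht.trans_eq ?_
  push_cast
  ring

lemma SignedSumBound.pow (h : SignedSumBound X q b) (l : ℕ) :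
    SignedSumBound X (q ^ l) (b ^ l) := by
  induction l with
  | zero => simpa using signedSumBound_one X 1
  | succ l ih => simpa only [pow_succ] using ih.mul h

lemma SignedSumBound.two_pow {n : ℕ} (h : SignedSumBound X (2 ^ n) b) (t : ℕ) :
    SignedSumBound X (2 ^ t) (b ^ (t / n)) := by
  simpa only [← pow_mul, ← pow_add, Nat.mod_add_div, one_mul] using
    (signedSumBound_one X (2 ^ (t % n))).mul (h.pow (t / n))

end Group

lemma exists_units_smul_abs_eq (c : ℝ) : ∃ s : ℤˣ, s • |c| = c := by
  obtain h | h := abs_choice c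
  · exact ⟨1, by simp [h]⟩
  · exact ⟨-1, by simp [h]⟩

lemma mul_sum_abs_sub_le_norm_sum_smul {X : Type*} [SeminormedAddCommGroup X] [NormedSpace ℝ X]
    {ι : Type*} [Fintype ι] {x : ι → X} {D δ : ℝ} (hx : ∀ i, ‖x i‖ ≤ D)
    (h : ∀ s : ι → ℤˣ, Fintype.card ι * D - δ ≤ ‖∑ i, s i • x i‖)
    {c : ι → ℝ} {M : ℝ} (hM : 0 ≤ M) (hc : ∀ i, |c i| ≤ M) :
    D * ∑ i, |c i| - M * δ ≤ ‖∑ i, c i • x i‖ := by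
  choose s hs using fun i => exists_units_smul_abs_eq (c i)
  have split : M • ∑ i, s i • x i = ∑ i, c i • x i + ∑ i, s i • (M - |c i|) • x i := by
    rw [Finset.smul_sum, ← Finset.sum_add_distrib]
    refine Finset.sum_congr rfl fun i _ => ?_
    rw [← smul_assoc (s i) (M - |c i|), smul_sub, hs, sub_smul, add_sub_cancel, smul_assoc,
      smul_comm]
  have norm_rest_le : ‖∑ i, s i • (M - |c i|) • x i‖ ≤ ∑ i, (M - |c i|) * D := by
    refine norm_sum_le_of_le _ fun i _ => ?_
    have nonneg : 0 ≤ M - |c i| := sub_nonneg.2 (hc i)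
    rw [norm_units_zsmul, norm_smul, Real.norm_of_nonneg nonneg]
    exact mul_le_mul_of_nonneg_left (hx i) nonneg
  calc D * ∑ i, |c i| - M * δ = M * (Fintype.card ι * D - δ) - ∑ i, (M - |c i|) * D := by
        rw [← Finset.sum_mul, Finset.sum_sub_distrib, Finset.sum_const, Finset.card_univ,
          nsmul_eq_mul]
        ring
    _ ≤ ‖M • ∑ i, s i • x i‖ - ‖∑ i, s i • (M - |c i|) • x i‖ := by
        rw [norm_smul, Real.norm_of_nonneg hM]
        gcongr
        exact h s
    _ ≤ ‖∑ i, c i • x i‖ := by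
        rw [split, sub_le_iff_le_add]
        exact norm_add_le _ _

section Normed

variable {X : Type*} [NormedAddCommGroup X] [NormedSpace ℝ X] {n : ℕ}

lemma le_norm_rademacherProj {x : (Fin n → ℤˣ) → X} {D : ℝ} (hn : n ≠ 0)
    (hx : ∀ ω, ‖x ω‖ ≤ D)
    (h : ∀ s : (Fin n → ℤˣ) → ℤˣ, (1 - 1 / n) * 2 ^ n * D ≤ ‖∑ ω, s ω • x ω‖)
    (ε : Fin n → ℤˣ) : (√n / √3 - 1) * D ≤ ‖rademacherProj x ε‖ := by
  have hD : 0 ≤ D := (norm_nonneg _).trans (hx ε)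
  have abs_sign (u : ℤˣ) : |((u : ℤ) : ℝ)| = 1 := by
    obtain rfl | rfl := Int.units_eq_one_or u <;> simp
  have norm_sign_le (i : Fin n) : ‖((ε i : ℤ) : ℝ)‖ ≤ 1 := (abs_sign (ε i)).le
  have coeff_le (ω : Fin n → ℤˣ) : |∑ i, ω i • ((ε i : ℤ) : ℝ)| ≤ n := by
    simpa using norm_sum_units_smul_le norm_sign_le ω
  have sum_coeff : 2 ^ n * √n ≤ √3 * ∑ ω : Fin n → ℤˣ, |∑ i, ω i • ((ε i : ℤ) : ℝ)| := by
    simpa [← sq_abs, abs_sign] using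
      two_pow_mul_sqrt_le_sum_cube_abs fun i => ((ε i : ℤ) : ℝ)
  have deficit : Fintype.card (Fin n → ℤˣ) * D - 2 ^ n * D / n = (1 - 1 / n) * 2 ^ n * D := by
    simp only [Fintype.card_pi_const, Fintype.card_units_int]
    push_cast
    ring
  have almost_l1 := mul_sum_abs_sub_le_norm_sum_smul hx
    (fun s => deficit.trans_le (h s)) n.cast_nonneg coeff_le
  rw [rademacherProj_eq_sum_smul, norm_smul, norm_inv, norm_pow, Real.norm_ofNat,
    le_inv_mul_iff₀ (by positivity)]
  calc 2 ^ n * ((√n / √3 - 1) * D) = D * (2 ^ n * √n / √3) - n * (2 ^ n * D / n) := by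
        field_simp
    _ ≤ D * ∑ ω : Fin n → ℤˣ, |∑ i, ω i • ((ε i : ℤ) : ℝ)| - n * (2 ^ n * D / n) := by
        gcongr
        rwa [div_le_iff₀' (by positivity)]
    _ ≤ _ := almost_l1

lemma signedSumBound_of_cubeL2Norm_rademacherProj_le {C : ℝ≥0}
    (hC : ∀ f : (Fin n → ℤˣ) → X, cubeL2Norm (rademacherProj f) ≤ C * cubeL2Norm f)
    (hn : 3 * (C + 1) ^ 2 < (n : ℝ)) : SignedSumBound X (2 ^ n) (1 - 1 / n) := by
  have hn_pos : (0 : ℝ) < n := hn.trans_le' (by positivity)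
  have hC_lt : C < √n / √3 - 1 := by
    rw [lt_sub_iff_add_lt, lt_div_iff₀ (by positivity)]
    exact Real.lt_sqrt_of_sq_lt (by rwa [mul_pow, Real.sq_sqrt zero_le_three, mul_comm])
  rw [signedSumBound_iff_of_card (ι := Fin n → ℤˣ) (by simp)]
  intro D x hx
  by_contra! hlong
  push_cast at hlong
  have hD : 0 < D := by
    refine ((norm_nonneg _).trans (hx 1)).lt_of_ne fun hD => ?_
    simpa [← hD] using (hlong 1).trans_le (norm_sum_units_smul_le hx 1)
  have lower : (√n / √3 - 1) * D ≤ cubeL2Norm (rademacherProj x) :=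
    le_cubeL2Norm (mul_nonneg (C.2.trans hC_lt.le) hD.le)
      (le_norm_rademacherProj (by exact_mod_cast hn_pos.ne') hx fun s => (hlong s).le)
  have upper : cubeL2Norm (rademacherProj x) ≤ C * D :=
    (hC x).trans (mul_le_mul_of_nonneg_left (cubeL2Norm_le hD.le hx) C.2)
  exact (mul_lt_mul_of_pos_right hC_lt hD).not_ge (lower.trans upper)

end Normed

lemma summable_pow_div {θ : ℝ} (hθ0 : 0 ≤ θ) (hθ1 : θ < 1) (n : ℕ) [NeZero n] :
    Summable fun t : ℕ => θ ^ (t / n) := by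
  have summable_prod : Summable fun p : ℕ × Fin n => θ ^ p.1 * 1 :=
    (summable_geometric_of_lt_one hθ0 hθ1).mul_of_nonneg (g := fun _ : Fin n => 1) .of_finite
      (fun _ => pow_nonneg hθ0 _) fun _ => zero_le_one
  simpa [Function.comp_def] using (Nat.divModEquiv n).summable_iff.2 summable_prod

end SignedSums

section Averages

lemma ordConnected_of_isClosed_of_midpoint_mem {I : Set ℝ} (hI : IsClosed I)
    (hmid : ∀ a ∈ I, ∀ b ∈ I, midpoint ℝ a b ∈ I) : I.OrdConnected := by
  refine ⟨fun u hu v hv t ⟨hut, htv⟩ => ?_⟩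
  have bdd_below_t : BddAbove (I ∩ Set.Iic t) := ⟨t, fun _ h => h.2⟩
  have bdd_above_t : BddBelow (I ∩ Set.Ici t) := ⟨t, fun _ h => h.2⟩
  have ha := (hI.inter isClosed_Iic).csSup_mem ⟨u, hu, hut⟩ bdd_below_t
  have hb := (hI.inter isClosed_Ici).csInf_mem ⟨v, hv, htv⟩ bdd_above_t
  set a := sSup (I ∩ Set.Iic t)
  set b := sInf (I ∩ Set.Ici t)
  have hat : a ≤ t := ha.2
  have htb : t ≤ b := hb.2
  have hm : (a + b) / 2 ∈ I := by
    simpa [midpoint_eq_smul_add, div_eq_inv_mul] using hmid a ha.1 b hb.1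
  obtain h | h := le_total ((a + b) / 2) t
  · have : (a + b) / 2 ≤ a := le_csSup bdd_below_t ⟨hm, h⟩
    rw [show t = b by linarith]
    exact hb.1
  · have : b ≤ (a + b) / 2 := csInf_le bdd_above_t ⟨hm, h⟩
    rw [show t = a by linarith]
    exact ha.1

section TopologicalVectorSpace

variable {E : Type*} [AddCommGroup E] [Module ℝ E]

/-- The averages of `q` points of `A`, repetitions allowed: the finite approximations of the points
of the convex hull of `A`. For `q = 0` the only average is `0`. -/
def averages (A : Set E) (q : ℕ) : Set E :=
  {z | ∃ y : Fin q → E, (∀ i, y i ∈ A) ∧ (q : ℝ)⁻¹ • ∑ i, y i = z}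

lemma mem_averages_iff_of_card {A : Set E} {q : ℕ} {ι : Type*} [Fintype ι]
    (hι : Fintype.card ι = q) {z : E} :
    z ∈ averages A q ↔ ∃ y : ι → E, (∀ i, y i ∈ A) ∧ (q : ℝ)⁻¹ • ∑ i, y i = z := by
  have e : ι ≃ Fin q := Fintype.equivFinOfCardEq hι
  constructor
  · rintro ⟨y, hy, rfl⟩
    exact ⟨y ∘ e, fun _ => hy _, by simp [← e.sum_comp y]⟩
  · rintro ⟨y, hy, rfl⟩
    exact ⟨y ∘ e.symm, fun _ => hy _, by simp [← e.symm.sum_comp y]⟩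

lemma subset_averages_one (A : Set E) : A ⊆ averages A 1 :=
  fun a ha => ⟨fun _ => a, fun _ => ha, by simp⟩

lemma midpoint_mem_averages {A : Set E} {q : ℕ} {a b : E} (ha : a ∈ averages A q)
    (hb : b ∈ averages A q) : midpoint ℝ a b ∈ averages A (q * 2) := by
  obtain ⟨y, hy, rfl⟩ := ha
  obtain ⟨z, hz, rfl⟩ := hb
  refine (mem_averages_iff_of_card (ι := Fin q ⊕ Fin q) (by simp [mul_two])).2
    ⟨Sum.elim y z, by simp [hy, hz], ?_⟩
  rw [midpoint_eq_smul_add, Fintype.sum_sum_type, ← smul_add, smul_smul]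
  simp [mul_comm]

lemma monotone_averages_two_pow (A : Set E) : Monotone fun t => averages A (2 ^ t) := by
  refine monotone_nat_of_le_succ fun t a ha => ?_
  simpa only [midpoint_self, pow_succ] using midpoint_mem_averages ha ha

variable [TopologicalSpace E] [IsTopologicalAddGroup E] [ContinuousSMul ℝ E]

lemma convex_of_isClosed_of_midpoint_mem {S : Set E} (hS : IsClosed S)
    (hmid : ∀ x ∈ S, ∀ y ∈ S, midpoint ℝ x y ∈ S) : Convex ℝ S := by
  refine convex_iff_segment_subset.2 fun x hx y hy => ?_
  rw [segment_eq_image_lineMap, Set.image_subset_iff]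
  have ordConnected : (AffineMap.lineMap x y ⁻¹' S : Set ℝ).OrdConnected :=
    ordConnected_of_isClosed_of_midpoint_mem (hS.preimage AffineMap.lineMap_continuous)
      fun a ha b hb => by simpa only [Set.mem_preimage, AffineMap.map_midpoint] using hmid _ ha _ hb
  exact ordConnected.out (by simpa using hx) (by simpa using hy)

lemma convexHull_subset_closure_iUnion_averages (A : Set E) :
    convexHull ℝ A ⊆ closure (⋃ t, averages A (2 ^ t)) := by
  refine convexHull_min ?_ (convex_of_isClosed_of_midpoint_mem isClosed_closure ?_)
  · exact ((subset_averages_one A).trans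
      (Set.subset_iUnion (fun t => averages A (2 ^ t)) 0)).trans subset_closure
  have continuous_midpoint : Continuous fun p : E × E => midpoint ℝ p.1 p.2 := by
    simp only [midpoint_eq_smul_add]
    fun_prop
  refine fun a ha b hb => map_mem_closure₂ continuous_midpoint ha hb fun x hx y hy => ?_
  obtain ⟨s, hs⟩ := Set.mem_iUnion.1 hx
  obtain ⟨t, ht⟩ := Set.mem_iUnion.1 hy
  exact Set.mem_iUnion.2 ⟨max s t + 1, midpoint_mem_averages
    (monotone_averages_two_pow A (le_max_left s t) hs)
    (monotone_averages_two_pow A (le_max_right s t) ht)⟩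

end TopologicalVectorSpace

section SeminormedSpace

variable {X : Type*} [SeminormedAddCommGroup X] [NormedSpace ℝ X] {A : Set X} {D : ℝ}

lemma SignedSumBound.exists_mem_averages_near {q : ℕ} {b : ℝ} (h : SignedSumBound X q b)
    (hq : q ≠ 0) (hA : ∀ a ∈ A, ∀ a' ∈ A, ‖a - a'‖ ≤ D) {z : X} (hz : z ∈ averages A (q * 2)) :
    ∃ w ∈ averages A q, ‖w - z‖ ≤ D / 2 * b := by
  obtain ⟨y, hy, rfl⟩ :=
    (mem_averages_iff_of_card (ι := Fin q ⊕ Fin q) (by simp [mul_two])).1 hz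
  obtain ⟨s, hs⟩ := h D (fun i => y (.inl i) - y (.inr i)) fun i => hA _ (hy _) _ (hy _)
  have select (i : Fin q) : ∃ a ∈ A,
      (2 : ℝ) • a = y (.inl i) + y (.inr i) + s i • (y (.inl i) - y (.inr i)) := by
    obtain hi | hi := Int.units_eq_one_or (s i)
    · exact ⟨y (.inl i), hy _, by rw [hi, one_smul]; module⟩
    · exact ⟨y (.inr i), hy _, by rw [hi, Units.neg_smul, one_smul]; module⟩
  choose w hwA hw using select
  refine ⟨_, ⟨w, hwA, rfl⟩, ?_⟩
  have difference : (q : ℝ)⁻¹ • ∑ i, w i - ((q * 2 : ℕ) : ℝ)⁻¹ • ∑ k, y k =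
      ((q * 2 : ℕ) : ℝ)⁻¹ • ∑ i, s i • (y (.inl i) - y (.inr i)) := by
    have half : (q : ℝ)⁻¹ = ((q * 2 : ℕ) : ℝ)⁻¹ * 2 := by
      push_cast
      field_simp
    rw [half, mul_smul, ← smul_sub, Finset.smul_sum, Fintype.sum_sum_type]
    simp only [hw, Finset.sum_add_distrib, add_sub_cancel_left]
  rw [difference, norm_smul, norm_inv, Real.norm_natCast, inv_mul_le_iff₀ (by positivity)]
  refine hs.trans_eq ?_
  push_cast
  ring

lemma exists_mem_averages_two_pow_near {b : ℕ → ℝ} (h : ∀ t, SignedSumBound X (2 ^ t) (b t))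
    (hA : ∀ a ∈ A, ∀ a' ∈ A, ‖a - a'‖ ≤ D) {s t : ℕ} (hst : s ≤ t) {z : X}
    (hz : z ∈ averages A (2 ^ t)) :
    ∃ w ∈ averages A (2 ^ s), ‖w - z‖ ≤ ∑ i ∈ Finset.Ico s t, D / 2 * b i := by
  induction t, hst using Nat.le_induction generalizing z with
  | base => exact ⟨z, hz, by simp⟩
  | succ t hst ih =>
    obtain ⟨v, hv, hvz⟩ := (h t).exists_mem_averages_near (by positivity) hA hz
    obtain ⟨w, hw, hwv⟩ := ih hv
    refine ⟨w, hw, ?_⟩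
    rw [Finset.sum_Ico_succ_top hst]
    exact (norm_sub_le_norm_sub_add_norm_sub w v z).trans (add_le_add hwv hvz)

lemma exists_mem_averages_near_convexHull {b : ℕ → ℝ} (h : ∀ t, SignedSumBound X (2 ^ t) (b t))
    (hA : ∀ a ∈ A, ∀ a' ∈ A, ‖a - a'‖ ≤ D) {s : ℕ} {ε η : ℝ} (hεη : ε < η)
    (hs : ∀ t ≥ s, ∑ i ∈ Finset.Ico s t, D / 2 * b i ≤ ε) {z : X} (hz : z ∈ convexHull ℝ A) :
    ∃ w ∈ averages A (2 ^ s), ‖w - z‖ < η := by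
  obtain ⟨v, hv, hzv⟩ := Metric.mem_closure_iff.1
    (convexHull_subset_closure_iUnion_averages A hz) (η - ε) (sub_pos.2 hεη)
  obtain ⟨t, ht⟩ := Set.mem_iUnion.1 hv
  obtain ⟨w, hw, hwv⟩ := exists_mem_averages_two_pow_near h hA (le_max_right t s)
    (monotone_averages_two_pow A (le_max_left t s) ht)
  refine ⟨w, hw, ?_⟩
  rw [dist_comm, dist_eq_norm] at hzv
  calc ‖w - z‖ ≤ ‖w - v‖ + ‖v - z‖ := norm_sub_le_norm_sub_add_norm_sub w v z
    _ < ε + (η - ε) := add_lt_add_of_le_of_lt (hwv.trans (hs _ (le_max_right t s))) hzv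
    _ = η := add_sub_cancel _ _

end SeminormedSpace

end Averages

section Packing

section NormedGroup

variable {X : Type*} [NormedAddCommGroup X] {K B : Set X}

lemma packNum_le_card {ι : Type*} (p : ι → X) (hp : ∀ a ∈ K, ∃ i, p i ∈ a +ᵥ interior B) :
    packNum K B ≤ ENat.card ι := by
  choose g hg using hp
  refine iSup_le fun S => iSup₂_le fun hSK hS => ?_
  have injective : Function.Injective fun a : S => g a (hSK a.2) := by
    intro a b hab
    dsimp only at hab
    by_contra hne
    refine Set.disjoint_left.1 (hS a.2 b.2 (Subtype.coe_ne_coe.2 hne)) (hg a (hSK a.2)) ?_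
    rw [hab]
    exact hg b (hSK b.2)
  exact ENat.card_le_card_of_injective injective

end NormedGroup

variable {X : Type*} [NormedAddCommGroup X] [NormedSpace ℝ X] {K B : Set X} {N : ℕ} {x : Fin N → X}

lemma IsConvexlySeparated.le_convPackNum (hx : IsConvexlySeparated B x) (hxK : ∀ j, x j ∈ K) :
    N ≤ convPackNum K B :=
  le_iSup₂_of_le (f := fun (N : ℕ) (_ : ∃ x : Fin N → X,
    (∀ j, x j ∈ K) ∧ IsConvexlySeparated B x) => (N : ℕ∞)) N ⟨x, hxK, hx⟩ le_rfl

lemma exists_isConvexlySeparated_of_convPackNum_ne_top (h : convPackNum K B ≠ ⊤) :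
    ∃ (N : ℕ) (x : Fin N → X), (∀ j, x j ∈ K) ∧ IsConvexlySeparated B x ∧
      convPackNum K B = N := by
  let Realized (N : ℕ) : Prop := ∃ x : Fin N → X, (∀ j, x j ∈ K) ∧ IsConvexlySeparated B x
  have eq_iSup : convPackNum K B = ⨆ N : Subtype Realized, (N : ℕ∞) := iSup_subtype'
  have : Nonempty (Subtype Realized) := ⟨0, finZeroElim, finZeroElim, finZeroElim⟩
  obtain ⟨⟨N, x, hxK, hx⟩, hN⟩ := ENat.exists_eq_iSup_of_lt_top (eq_iSup ▸ h.lt_top)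
  exact ⟨N, x, hxK, hx, eq_iSup.trans hN.symm⟩

lemma IsConvexlySeparated.snoc (hx : IsConvexlySeparated B x) {a : X}
    (ha : (a +ᵥ interior B) ∩ convexHull ℝ (Set.range x) = ∅) :
    IsConvexlySeparated B (Fin.snoc x a : Fin (N + 1) → X) := by
  refine Fin.lastCases ?_ fun j => ?_
  · rw [Fin.snoc_last]
    refine Set.subset_eq_empty (Set.inter_subset_inter_right _ (convexHull_mono ?_)) ha
    rintro _ ⟨i, hi, rfl⟩
    obtain ⟨i, rfl⟩ := Fin.exists_castSucc_eq.2 hi.ne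
    exact ⟨i, by simp⟩
  · rw [Fin.snoc_castSucc]
    refine Set.subset_eq_empty (Set.inter_subset_inter_right _ (convexHull_mono ?_)) (hx j)
    rintro _ ⟨i, hi, rfl⟩
    obtain ⟨i, rfl⟩ := Fin.exists_castSucc_eq.2 (hi.trans (Fin.castSucc_lt_last j)).ne
    exact ⟨i, by simpa using hi, by simp⟩

lemma IsConvexlySeparated.inter_convexHull_nonempty (hx : IsConvexlySeparated B x)
    (hxK : ∀ j, x j ∈ K) (hmax : convPackNum K B ≤ N) {a : X} (ha : a ∈ K) :
    ((a +ᵥ interior B) ∩ convexHull ℝ (Set.range x)).Nonempty := by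
  by_contra! hdisjoint
  have hsnocK : ∀ j, (Fin.snoc x a : Fin (N + 1) → X) j ∈ K :=
    Fin.lastCases (by simpa using ha) fun j => by simpa using hxK j
  have hle : ((N + 1 : ℕ) : ℕ∞) ≤ N := ((hx.snoc hdisjoint).le_convPackNum hsnocK).trans hmax
  exact N.lt_succ_self.not_ge (by exact_mod_cast hle)

lemma packNum_le_convPackNum_pow {U : Set X} (hU : Convex ℝ U) {q : ℕ} (hq : q ≠ 0)
    (h : ∀ A ⊆ K, ∀ z ∈ convexHull ℝ A, ∃ w ∈ averages A q, w - z ∈ (1 / 2 : ℝ) • U) :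
    packNum K U ≤ convPackNum K ((1 / 2 : ℝ) • U) ^ q := by
  by_cases htop : convPackNum K ((1 / 2 : ℝ) • U) = ⊤
  · rw [htop, ENat.top_pow hq]
    exact le_top
  obtain ⟨N, x, hxK, hx, hN⟩ := exists_isConvexlySeparated_of_convPackNum_ne_top htop
  have interior_add_half : interior ((1 / 2 : ℝ) • U) + (1 / 2 : ℝ) • U ⊆ interior U := by
    refine subset_interior_add_left.trans_eq ?_
    rw [← hU.add_smul (by norm_num) (by norm_num), add_halves, one_smul]
  have average_mem (a : X) (ha : a ∈ K) :
      ∃ g : Fin q → Fin N, (q : ℝ)⁻¹ • ∑ i, x (g i) ∈ a +ᵥ interior U := by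
    obtain ⟨z, hza, hz⟩ := hx.inter_convexHull_nonempty hxK hN.le ha
    obtain ⟨w, ⟨y, hy, rfl⟩, hw⟩ := h _ (Set.range_subset_iff.2 hxK) z hz
    choose g hg using hy
    refine ⟨g, ?_⟩
    rw [Set.mem_vadd_set_iff_neg_vadd_mem, vadd_eq_add] at hza ⊢
    simpa only [hg, add_add_sub_cancel, neg_add_cancel_left] using
      interior_add_half (Set.add_mem_add hza hw)
  rw [hN]
  refine (packNum_le_card _ average_mem).trans_eq ?_
  simp [ENat.card_eq_coe_fintype_card]

end Packing

lemma log₂_monotone : Monotone log₂ := fun _ _ h =>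
  EReal.div_le_div_right_of_nonneg (EReal.coe_nonneg.2 (Real.log_nonneg one_le_two))
    (ENNReal.log_monotone (ENat.toENNReal_le.2 h))

lemma log₂_pow (m : ℕ∞) (q : ℕ) : log₂ (m ^ q) = q * log₂ m := by
  rw [log₂, log₂, ENat.toENNReal_pow, ENNReal.log_pow, EReal.mul_div]

lemma log₂_packNum_le {X : Type*} [NormedAddCommGroup X] [NormedSpace ℝ X] {b : ℕ → ℝ}
    (h : ∀ t, SignedSumBound X (2 ^ t) (b t)) {T U : Set X} {D r ε : ℝ}
    (hT : ∀ a ∈ T, ∀ a' ∈ T, ‖a - a'‖ ≤ D) (hU : Convex ℝ U)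
    (hrU : Metric.closedBall 0 r ⊆ U) {s : ℕ} (hε : ε < r / 2)
    (hs : ∀ t ≥ s, ∑ i ∈ Finset.Ico s t, D / 2 * b i ≤ ε) :
    log₂ (packNum T U) ≤ (2 ^ s : ℕ) * log₂ (convPackNum T ((1 / 2 : ℝ) • U)) := by
  rw [← log₂_pow]
  refine log₂_monotone (packNum_le_convPackNum_pow hU (by positivity) fun A hAT z hz => ?_)
  obtain ⟨w, hw, hwz⟩ := exists_mem_averages_near_convexHull h
    (fun a ha a' ha' => hT a (hAT ha) a' (hAT ha')) hε hs hz
  refine ⟨w, hw, Set.smul_set_mono hrU ?_⟩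
  rw [Set.mem_smul_set_iff_inv_smul_mem₀ (by norm_num), mem_closedBall_zero_iff, norm_smul]
  rw [norm_inv, Real.norm_of_nonneg (by norm_num)]
  linarith

lemma exists_summable_signedSumBound (κ : ℝ≥0) :
    ∃ b : ℕ → ℝ, Summable b ∧ ∀ (X : Type u) [NormedAddCommGroup X] [NormedSpace ℝ X],
      kConvexityConst X ≤ κ → ∀ t, SignedSumBound X (2 ^ t) (b t) := by
  obtain ⟨n, hn⟩ := exists_nat_gt (3 * ((κ : ℝ) + 1) ^ 2)
  have one_le_n : (1 : ℝ) ≤ n := by nlinarith [κ.coe_nonneg]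
  have : NeZero n := ⟨by rintro rfl; norm_num at one_le_n⟩
  refine ⟨fun t => (1 - 1 / n) ^ (t / n), summable_pow_div ?_ ?_ n, fun X _ _ hX => ?_⟩
  · exact sub_nonneg.2 (div_le_one_of_le₀ one_le_n n.cast_nonneg)
  · exact sub_lt_self _ (by positivity)
  · exact (signedSumBound_of_cubeL2Norm_rademacherProj_le
      (fun f => cubeL2Norm_rademacherProj_le hX f) hn).two_pow

theorem mainTheorem3_general :
    ∃ β : ℝ≥0 → ℝ → ℝ → ℝ, (∀ κ D r, 0 < β κ D r) ∧
      ∀ (X : Type u) [NormedAddCommGroup X] [NormedSpace ℝ X] (κ : ℝ≥0),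
        kConvexityConst X ≤ κ →
        ∀ (D r : ℝ), 0 < r → ∀ T U : Set X, Bornology.IsBounded T → Metric.diam T ≤ D →
          Convex ℝ U → Metric.closedBall 0 r ⊆ U →
          log₂ (packNum T U) ≤
            (β κ D r : EReal) * log₂ (convPackNum T ((1 / 2 : ℝ) • U)) := by
  choose b hb_summable hb using exists_summable_signedSumBound.{u}
  have tail (κ : ℝ≥0) (D r : ℝ) (hr : 0 < r) :
      ∃ s : ℕ, ∀ t ≥ s, ∑ i ∈ Finset.Ico s t, D / 2 * b κ i ≤ r / 4 := by
    have cauchy := ((hb_summable κ).mul_left (D / 2)).hasSum.tendsto_sum_nat.cauchySeq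
    obtain ⟨s, hs⟩ := Metric.cauchySeq_iff'.1 cauchy (r / 4) (by positivity)
    refine ⟨s, fun t ht => ?_⟩
    rw [Finset.sum_Ico_eq_sub _ ht]
    exact (le_abs_self _).trans (hs t ht).le
  choose! s hs using tail
  refine ⟨fun κ D r => (2 ^ s κ D r : ℕ), fun κ D r => by positivity,
    fun X _ _ κ hX D r hr T U hT hTD hU hrU => ?_⟩
  refine log₂_packNum_le (hb κ X hX) (fun a ha a' ha' => ?_) hU hrU (by linarith) (hs κ D r hr)
  rw [← dist_eq_norm]
  exact (Metric.dist_le_diam_of_mem hT ha ha').trans hTD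

theorem mainTheorem3 :
    (∃ β : ℝ≥0 → ℝ → ℝ, (∀ κ d, 0 < β κ d) ∧
      ∀ (X : Type u) [NormedAddCommGroup X] [NormedSpace ℝ X] (κ : ℝ≥0),
        kConvexityConst X ≤ κ →
        ∀ T : Set X, Bornology.IsBounded T →
          log₂ (packNum T (Metric.closedBall 0 1)) ≤
            (β κ (Metric.diam T) : EReal) *
              log₂ (convPackNum T ((1 / 2 : ℝ) • Metric.closedBall (0 : X) 1))) ∧
    (∃ β' : ℝ≥0 → ℝ → ℝ, (∀ κ r, 0 < β' κ r) ∧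
      ∀ (X : Type u) [NormedAddCommGroup X] [NormedSpace ℝ X] (κ : ℝ≥0),
        kConvexityConst X ≤ κ →
        ∀ (r : ℝ), 0 < r →
        ∀ U : Set X, Convex ℝ U → (∀ x ∈ U, -x ∈ U) → r • Metric.closedBall (0 : X) 1 ⊆ U →
          log₂ (packNum (Metric.closedBall 0 1) U) ≤
            (β' κ r : EReal) *
              log₂ (convPackNum (Metric.closedBall 0 1) ((1 / 2 : ℝ) • U))) := by
  obtain ⟨β, hβ, h⟩ := mainTheorem3_general.{u}
  refine ⟨⟨fun κ d => β κ d 1, fun κ d => hβ κ d 1, fun X _ _ κ hX T hT => ?_⟩,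
    ⟨fun κ r => β κ 2 r, fun κ r => hβ κ 2 r, fun X _ _ κ hX r hr U hU _ hrU => ?_⟩⟩
  · exact h X κ hX _ 1 one_pos T _ hT le_rfl (convex_closedBall 0 1) subset_rfl
  · rw [smul_unitClosedBall_of_nonneg hr.le] at hrU
    exact h X κ hX 2 r hr _ U Metric.isBounded_closedBall
      ((Metric.diam_closedBall zero_le_one).trans_eq (mul_one 2)) hU hrU
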